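/- Let $\mathcal M$ be the commutative monoid presented by the generators $x_n, y_n, z_n$ ($n\ge 0$) and $a_n$ ($n\ge 1$) and the relations $$x_0+y_0=x_0+z_0,\qquad y_l=y_{l+1}+a_{l+1},\qquad z_l=z_{l+1}+a_{l+1},\qquad x_l=x_{l+1}+y_{l+1}=x_{l+1}+z_{l+1}\qquad(l\ge 0),$$ and put $u:=x_0+y_0\in\mathcal M$. For a (not necessarily unital) ring $R$, let $V(R)$ be the commutative monoid of equivalence classes $[e]$ of idempotent square matrices $e$ of arbitrary finite size over $R$, where $e\sim f$ if there are rectangular matrices $v,w$ over $R$ with $vw=e$ and $wv=f$, and $[e]+[f]:=\left[\left(\begin{smallmatrix}e&0\\0&f\end{smallmatrix}\right)\right]$. (When $R$ is unital, this is the monoid of isomorphism classes of finitely generated projective left $R$-modules, with addition induced by direct sum.) The ring $R$ is called regular if for every $a\in R$ there is $b\in R$ with $aba=a$. Then: 1. $\mathcal M$ admits a faithful state: $u$ is an order-unit of $\mathcal M$ (for every $m\in\mathcal M$ there are $k\in\mathbb N$ and $c\in\mathcal M$ with $m+c=ku$), and there is a monoid homomorphism $s\colon\mathcal M\to\mathbb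 R_{\ge 0}$ with $s(u)=1$ and $s^{-1}(0)=\{0\}$. 2. $\mathcal M$ is not cancellative. 3. For every uncountable field $K$ and every (not necessarily unital) regular $K$-algebra $R$, the monoids $\mathcal M$ and $V(R)$ are not isomorphic. -/

import Mathlib

open scoped NNReal

namespace WildMonoid

/-! ## Regular rings and the monoid `V(R)` of a (not necessarily unital) ring -/

/-- A (not necessarily unital) ring is (von Neumann) regular if every element `a` has a
quasi-inverse `b`, i.e. `a b a = a`. -/
def IsRegularRing (R : Type*) [NonUnitalRing R] : Prop :=
  ∀ a : R, ∃ b : R, a * b * a = a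

section V

variable {R : Type*} [NonUnitalRing R]

/-- Equivalence of square matrices `e`, `f`, possibly of different sizes:
there are rectangular matrices `u`, `v` over `R` with `u v = e` and `v u = f`. -/
def MatEquiv {ι κ : Type*} [Fintype ι] [Fintype κ] (e : Matrix ι ι R) (f : Matrix κ κ R) : Prop :=
  ∃ (u : Matrix ι κ R) (v : Matrix κ ι R), u * v = e ∧ v * u = f

section lemmas

variable {ι κ μ ν : Type*} [Fintype ι] [Fintype κ] [Fintype μ] [Fintype ν]

theorem MatEquiv.symm {e : Matrix ι ι R} {f : Matrix κ κ R} (h : MatEquiv e f) :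
    MatEquiv f e := by
  obtain ⟨u, v, h1, h2⟩ := h
  exact ⟨v, u, h2, h1⟩

theorem MatEquiv.trans {e : Matrix ι ι R} {f : Matrix κ κ R} {g : Matrix μ μ R}
    (he : e * e = e) (hg : g * g = g) (h : MatEquiv e f) (h' : MatEquiv f g) :
    MatEquiv e g := by
  obtain ⟨u, v, h1, h2⟩ := h
  obtain ⟨u', v', h3, h4⟩ := h'
  refine ⟨u * u', v' * v, ?_, ?_⟩
  · calc u * u' * (v' * v) = u * (u' * v') * v := by simp only [Matrix.mul_assoc]
      _ = (u * v) * (u * v) := by rw [h3, ← h2]; simp only [Matrix.mul_assoc]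
      _ = e := by rw [h1, he]
  · calc v' * v * (u * u') = v' * (v * u) * u' := by simp only [Matrix.mul_assoc]
      _ = (v' * u') * (v' * u') := by rw [h2, ← h3]; simp only [Matrix.mul_assoc]
      _ = g := by rw [h4, hg]

theorem MatEquiv.of_submatrix {e : Matrix ι ι R} (he : e * e = e) (σ : κ ≃ ι) :
    MatEquiv e (e.submatrix σ σ) := by
  refine ⟨e.submatrix id σ, e.submatrix σ id, ?_, ?_⟩
  · rw [Matrix.submatrix_mul_equiv, he, Matrix.submatrix_id_id]
  · rw [← Matrix.submatrix_mul _ _ σ id σ Function.bijective_id, he]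

theorem MatEquiv.fromBlocks {e : Matrix ι ι R} {f : Matrix κ κ R} {e' : Matrix μ μ R}
    {f' : Matrix ν ν R} (h : MatEquiv e e') (h' : MatEquiv f f') :
    MatEquiv (Matrix.fromBlocks e 0 0 f) (Matrix.fromBlocks e' 0 0 f') := by
  obtain ⟨u, v, h1, h2⟩ := h
  obtain ⟨u', v', h3, h4⟩ := h'
  refine ⟨Matrix.fromBlocks u 0 0 u', Matrix.fromBlocks v 0 0 v', ?_, ?_⟩ <;>
  simp [Matrix.fromBlocks_multiply, h1, h2, h3, h4]

theorem fromBlocks_idem {e : Matrix ι ι R} {f : Matrix κ κ R} (he : e * e = e)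
    (hf : f * f = f) :
    Matrix.fromBlocks e 0 0 f * Matrix.fromBlocks e 0 0 f = Matrix.fromBlocks e 0 0 f := by
  simp [Matrix.fromBlocks_multiply, he, hf]

end lemmas

variable (R) in
/-- Idempotent square matrices over `R`, of arbitrary finite size. -/
structure IdemMat where
  size : ℕ
  mat : Matrix (Fin size) (Fin size) R
  idem : mat * mat = mat

/-- The block diagonal sum `diag(e, f)` of two idempotent matrices. -/
def IdemMat.diag (e f : IdemMat R) : IdemMat R where
  size := e.size + f.size
  mat := (Matrix.fromBlocks e.mat 0 0 f.mat).submatrix finSumFinEquiv.symm finSumFinEquiv.symm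
  idem := by rw [Matrix.submatrix_mul_equiv, fromBlocks_idem e.idem f.idem]

theorem IdemMat.diag_equiv (e f : IdemMat R) :
    MatEquiv (Matrix.fromBlocks e.mat 0 0 f.mat) (e.diag f).mat :=
  MatEquiv.of_submatrix (fromBlocks_idem e.idem f.idem) _

/-- The `0 × 0` matrix. -/
def IdemMat.empty : IdemMat R := ⟨0, 0, by simp⟩

variable (R) in
/-- Equivalence of idempotent matrices as a setoid. -/
def idemSetoid : Setoid (IdemMat R) where
  r e f := MatEquiv e.mat f.mat
  iseqv :=
    ⟨fun e => ⟨e.mat, e.mat, e.idem, e.idem⟩, fun h => h.symm,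
      fun {e _ g} h h' => h.trans e.idem g.idem h'⟩

variable (R) in
/-- The monoid `V(R)`: equivalence classes of idempotent matrices over `R`, with addition
`[e] + [f] = [diag(e, f)]`. -/
def V : Type _ := Quotient (idemSetoid R)

/-- The class `[e]` in `V(R)` of an idempotent matrix `e`. -/
def V.mk (e : IdemMat R) : V R := Quotient.mk (idemSetoid R) e

theorem IdemMat.diag_congr {e e' f f' : IdemMat R} (h : MatEquiv e.mat e'.mat)
    (h' : MatEquiv f.mat f'.mat) : MatEquiv (e.diag f).mat (e'.diag f').mat :=
  ((e.diag_equiv f).symm.trans (e.diag f).idem (fromBlocks_idem e'.idem f'.idem)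
    (h.fromBlocks h')).trans (e.diag f).idem (e'.diag f').idem (e'.diag_equiv f')

instance : Add (V R) :=
  ⟨Quotient.map₂ IdemMat.diag fun _ _ h _ _ h' => IdemMat.diag_congr h h'⟩

instance : Zero (V R) := ⟨V.mk IdemMat.empty⟩

theorem V.mk_add_mk (e f : IdemMat R) : V.mk e + V.mk f = V.mk (e.diag f) := rfl

theorem V.mk_eq_mk {e f : IdemMat R} : V.mk e = V.mk f ↔ MatEquiv e.mat f.mat :=
  Quotient.eq (r := idemSetoid R)

theorem V.add_comm' (a b : V R) : a + b = b + a := by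
  induction a using Quotient.inductionOn with | _ e
  induction b using Quotient.inductionOn with | _ f
  refine V.mk_eq_mk.2 ?_
  have h : MatEquiv (Matrix.fromBlocks e.mat 0 0 f.mat) (Matrix.fromBlocks f.mat 0 0 e.mat) := by
    have := MatEquiv.of_submatrix (fromBlocks_idem e.idem f.idem) (Equiv.sumComm _ _)
    convert this using 1
    ext (i | i) (j | j) <;> rfl
  exact ((e.diag_equiv f).symm.trans (e.diag f).idem (fromBlocks_idem f.idem e.idem) h).trans
    (e.diag f).idem (f.diag e).idem (f.diag_equiv e)

theorem V.zero_add' (a : V R) : 0 + a = a := by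
  induction a using Quotient.inductionOn with | _ e
  refine V.mk_eq_mk.2 ?_
  have h : MatEquiv (Matrix.fromBlocks (IdemMat.empty (R := R)).mat 0 0 e.mat) e.mat := by
    have := MatEquiv.of_submatrix (fromBlocks_idem (IdemMat.empty (R := R)).idem e.idem)
      (Equiv.emptySum (Fin 0) (Fin e.size)).symm
    convert this using 1
    ext i j
    rfl
  exact (IdemMat.diag_equiv _ e).symm.trans (IdemMat.diag _ e).idem e.idem h

theorem V.add_assoc' (a b c : V R) : a + b + c = a + (b + c) := by
  induction a using Quotient.inductionOn with | _ e
  induction b using Quotient.inductionOn with | _ f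
  induction c using Quotient.inductionOn with | _ g
  refine V.mk_eq_mk.2 ?_
  have hg : MatEquiv g.mat g.mat := ⟨g.mat, g.mat, g.idem, g.idem⟩
  have he : MatEquiv e.mat e.mat := ⟨e.mat, e.mat, e.idem, e.idem⟩
  have i1 := fromBlocks_idem (fromBlocks_idem e.idem f.idem) g.idem
  have i2 := fromBlocks_idem e.idem (fromBlocks_idem f.idem g.idem)
  have s1 : MatEquiv ((e.diag f).diag g).mat
      (Matrix.fromBlocks (Matrix.fromBlocks e.mat 0 0 f.mat) 0 0 g.mat) :=
    ((e.diag f).diag_equiv g).symm.trans ((e.diag f).diag g).idem i1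
      ((e.diag_equiv f).symm.fromBlocks hg)
  have s2 : MatEquiv (Matrix.fromBlocks e.mat 0 0 (Matrix.fromBlocks f.mat 0 0 g.mat))
      (e.diag (f.diag g)).mat :=
    (he.fromBlocks (f.diag_equiv g)).trans i2 (e.diag (f.diag g)).idem (e.diag_equiv (f.diag g))
  have s3 : MatEquiv (Matrix.fromBlocks (Matrix.fromBlocks e.mat 0 0 f.mat) 0 0 g.mat)
      (Matrix.fromBlocks e.mat 0 0 (Matrix.fromBlocks f.mat 0 0 g.mat)) := by
    have := MatEquiv.of_submatrix i1 (Equiv.sumAssoc _ _ _).symm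
    convert this using 1
    ext (i | i | i) (j | j | j) <;> rfl
  exact (s1.trans ((e.diag f).diag g).idem i2 s3).trans ((e.diag f).diag g).idem
    (e.diag (f.diag g)).idem s2

instance : AddCommMonoid (V R) where
  add_assoc := V.add_assoc'
  zero_add := V.zero_add'
  add_zero a := by rw [V.add_comm', V.zero_add']
  add_comm := V.add_comm'
  nsmul := nsmulRec

end V

/-! ## The monoid `𝓜` -/

/-- Generators of `𝓜`: `x n`, `y n`, `z n` are `xₙ`, `yₙ`, `zₙ` for `n ≥ 0`, and `a n` is
`aₙ₊₁`, so that the `a`'s are `a₁, a₂, …`. -/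
inductive Gen : Type
  | x (n : ℕ)
  | y (n : ℕ)
  | z (n : ℕ)
  | a (n : ℕ)

/-- The defining relations of `𝓜`, on the free commutative monoid (finite multisets) on the
generators. -/
inductive Rel : Multiset Gen → Multiset Gen → Prop
  | base : Rel ({Gen.x 0} + {Gen.y 0}) ({Gen.x 0} + {Gen.z 0})
  | y (l : ℕ) : Rel {Gen.y l} ({Gen.y (l + 1)} + {Gen.a l})
  | z (l : ℕ) : Rel {Gen.z l} ({Gen.z (l + 1)} + {Gen.a l})
  | xy (l : ℕ) : Rel {Gen.x l} ({Gen.x (l + 1)} + {Gen.y (l + 1)})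
  | xz (l : ℕ) : Rel {Gen.x l} ({Gen.x (l + 1)} + {Gen.z (l + 1)})

/-- The commutative monoid `𝓜` presented by the generators `Gen` and the relations `Rel`. -/
abbrev M : Type := (addConGen Rel).Quotient

/-- The class in `𝓜` of a generator. -/
def M.of (g : Gen) : M := (({g} : Multiset Gen) : (addConGen Rel).Quotient)

/-- The canonical order-unit `u = x₀ + y₀` of `𝓜`. -/
def M.u : M := M.of (Gen.x 0) + M.of (Gen.y 0)

/-! ## Order-units and states -/

/-- `u` is an order-unit of the commutative monoid `N`: every element is bounded above, in the
algebraic preorder, by a multiple of `u`. -/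
def IsOrderUnit {N : Type*} [AddCommMonoid N] (u : N) : Prop :=
  ∀ m : N, ∃ (k : ℕ) (c : N), m + c = k • u

/-- `s` is a faithful state on `(N, u)`: a homomorphism to the nonnegative reals, with value `1` at
the order-unit `u`, which vanishes only at `0`. -/
structure IsFaithfulState {N : Type*} [AddCommMonoid N] (u : N) (s : N →+ ℝ≥0) : Prop where
  orderUnit : IsOrderUnit u
  map_unit : s u = 1
  faithful : ∀ m : N, s m = 0 → m = 0

end WildMonoid

namespace WildMonoid

/-! Cancelling x₀ in the base relation would give y₀ = z₀, yet a homomorphism to `ℕ∞` separates the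
two; weights that halve at each level give a faithful state. It remains to see that V(R) is
cancellative as soon as it carries a faithful homomorphism to `ℝ≥0`
(`V.add_left_cancel_of_faithful`).

Such a homomorphism is a faithful rank on idempotent matrices. In a regular unital K-algebra,
idempotents below distinct eigenspaces of c are independent, so their ranks sum to at most N(1);
hence c - b is a unit for all but countably many scalars b (`countable_setOf_not_isUnit_sub`). As K
is uncountable, a scalar avoiding two such countable sets yields stable range one
(`exists_isUnit_add_mul`), which makes complements of equivalent idempotents equivalent. Corners of
matrix rings over R supply the unit; they are regular by `IsRegularRing.matrix_fin`. -/

/-- A faithful rank on the idempotents of a ring: invariant under equivalence of idempotents,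
additive on orthogonal idempotents, and vanishing only at `0`. -/
structure IsFaithfulRank {T : Type*} [NonUnitalRing T] (N : T → ℝ≥0) : Prop where
  equiv : ∀ u v : T, IsIdempotentElem (u * v) → IsIdempotentElem (v * u) → N (u * v) = N (v * u)
  add : ∀ e f : T, IsIdempotentElem e → IsIdempotentElem f → e * f = 0 → f * e = 0 →
    N (e + f) = N e + N f
  eq_zero : ∀ e : T, IsIdempotentElem e → N e = 0 → e = 0

theorem IsFaithfulRank.op {T : Type*} [NonUnitalRing T] {N : T → ℝ≥0} (hN : IsFaithfulRank N) :
    IsFaithfulRank fun x : Tᵐᵒᵖ => N x.unop where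
  equiv u v h h' := hN.equiv v.unop u.unop (congrArg MulOpposite.unop h)
    (congrArg MulOpposite.unop h')
  add e f he hf h h' := hN.add e.unop f.unop (congrArg MulOpposite.unop he)
    (congrArg MulOpposite.unop hf) (congrArg MulOpposite.unop h') (congrArg MulOpposite.unop h)
  eq_zero e he h := MulOpposite.unop_injective
    (hN.eq_zero e.unop (congrArg MulOpposite.unop he) h)

theorem IsRegularRing.op {T : Type*} [NonUnitalRing T] (hT : IsRegularRing T) :
    IsRegularRing Tᵐᵒᵖ := fun a => by
  obtain ⟨b, hb⟩ := hT a.unop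
  exact ⟨.op b, MulOpposite.unop_injective (by simpa [mul_assoc] using hb)⟩

/-! ### Countable spectra and stable range one in the unital case -/

section Unital

variable {K S : Type*} [Field K] [Ring S] [Algebra K S]

theorem aeval_mul_eq_eval_smul {c z : S} {b : K} (hz : (c - algebraMap K S b) * z = 0)
    (P : Polynomial K) : Polynomial.aeval c P * z = P.eval b • z := by
  obtain ⟨Q, hQ⟩ := Polynomial.X_sub_C_dvd_sub_C_eval (a := b) (p := P)
  have h := congrArg (Polynomial.aeval c) hQ
  rw [mul_comm] at h
  simp only [map_sub, map_mul, Polynomial.aeval_C, Polynomial.aeval_X] at h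
  have h2 := congrArg (· * z) h
  simp only [mul_assoc, hz, mul_zero, sub_mul, sub_eq_zero] at h2
  rw [h2, Algebra.smul_def]

/-- Independence of eigenspaces: P(c) kills z = gz, but acts on the b-eigenvector z as the nonzero
scalar P(b). -/
theorem eq_zero_of_aeval_mul {c g z : S} {b : K} {P : Polynomial K}
    (hg : Polynomial.aeval c P * g = 0) (hP : P.eval b ≠ 0)
    (hz : (c - algebraMap K S b) * z = 0) (hgz : g * z = z) : z = 0 := by
  have h := aeval_mul_eq_eval_smul hz P
  rw [← hgz, ← mul_assoc, hg, zero_mul, hgz] at h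
  exact (smul_eq_zero_iff_right hP).1 h.symm

/-- Idempotents below distinct eigenspaces of `c` have a direct sum inside `S`. -/
theorem exists_idempotent_rank_eq_sum (hS : IsRegularRing S) {N : S → ℝ≥0}
    (hN : IsFaithfulRank N) (c : S) (f : K → S) (hf : ∀ b, IsIdempotentElem (f b))
    (hcf : ∀ b, (c - algebraMap K S b) * f b = 0) (F : Finset K) :
    ∃ g : S, IsIdempotentElem g ∧
      Polynomial.aeval c (∏ b ∈ F, (Polynomial.X - Polynomial.C b)) * g = 0 ∧
      N g = ∑ b ∈ F, N (f b) := by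
  classical
  induction F using Finset.induction_on with
  | empty =>
    refine ⟨0, IsIdempotentElem.zero, mul_zero _, ?_⟩
    have h := hN.add 0 0 IsIdempotentElem.zero IsIdempotentElem.zero (mul_zero _) (mul_zero _)
    simpa using h
  | insert b F hb ih =>
    obtain ⟨g, hg, hPg, hNg⟩ := ih
    set P := ∏ b ∈ F, (Polynomial.X - Polynomial.C b) with hP
    have hPb : P.eval b ≠ 0 := by
      rw [hP, Polynomial.eval_prod, Finset.prod_ne_zero_iff]
      intro a ha
      simp only [Polynomial.eval_sub, Polynomial.eval_X, Polynomial.eval_C]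
      exact sub_ne_zero.2 fun h => hb (h ▸ ha)
    -- The part of `f b` outside g; k below is an idempotent with the same right ideal as h,
    -- orthogonal to g.
    set h := (1 - g) * f b with hh
    obtain ⟨h', hreg⟩ := hS h
    have hgh : g * h = 0 := by rw [hh, ← mul_assoc, mul_sub, mul_one, hg.eq, sub_self, zero_mul]
    have hfb : h * f b = h := by rw [hh, mul_assoc, (hf b).eq]
    have h1g : (1 - g) * h = h := by rw [sub_mul, hgh, one_mul, sub_zero]
    set k := h * h' * (1 - g) with hk
    clear_value h P
    have hkh : k * h = h := by rw [hk, mul_assoc, h1g, hreg]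
    have hki : IsIdempotentElem k := by
      rw [IsIdempotentElem]; nth_rw 2 [hk]
      rw [← mul_assoc, ← mul_assoc, hkh]
    have hgk : g * k = 0 := by rw [hk, ← mul_assoc, ← mul_assoc, hgh, zero_mul, zero_mul]
    have hkg : k * g = 0 := by rw [hk, mul_assoc, sub_mul, one_mul, hg.eq, sub_self, mul_zero]
    -- The discrepancy between the two sides lies in the b-eigenspace and, being killed by h, is
    -- fixed by g; so it vanishes by independence. Thus k is equivalent to `f b`.
    have hvu : f b * h' * (1 - g) * h = f b := by
      rw [mul_assoc, h1g, ← sub_eq_zero]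
      have h0 : h * (f b * h' * h - f b) = 0 := by
        rw [mul_sub, ← mul_assoc, ← mul_assoc, hfb, hreg, sub_self]
      have h1 : f b * (f b * h' * h - f b) = f b * h' * h - f b := by
        rw [mul_sub, ← mul_assoc, ← mul_assoc, (hf b).eq]
      refine eq_zero_of_aeval_mul (b := b) hPg hPb ?_ ?_
      · rw [← h1, ← mul_assoc, hcf, zero_mul]
      · have h2 : (1 - g) * (f b * (f b * h' * h - f b)) = 0 := by rw [← mul_assoc, ← hh, h0]
        rw [h1, sub_mul, one_mul, sub_eq_zero] at h2
        exact h2.symm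
    have huv : h * (f b * h' * (1 - g)) = k := by rw [hk, ← mul_assoc, ← mul_assoc, hfb]
    have hNk : N k = N (f b) := by
      have := hN.equiv h (f b * h' * (1 - g)) (by rwa [huv]) (by rw [hvu]; exact hf b)
      rwa [huv, hvu] at this
    have hPfb : Polynomial.aeval c ((Polynomial.X - Polynomial.C b) * P) * f b = 0 := by
      rw [mul_comm, map_mul, mul_assoc]
      simp [hcf]
    have hPg' : Polynomial.aeval c ((Polynomial.X - Polynomial.C b) * P) * g = 0 := by
      rw [map_mul, mul_assoc, hPg, mul_zero]
    refine ⟨g + k, ?_, ?_, ?_⟩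
    · rw [IsIdempotentElem, add_mul, mul_add, mul_add, hg.eq, hki.eq, hgk, hkg, add_zero, zero_add]
    · rw [Finset.prod_insert hb, ← hP, mul_add, hPg', zero_add, hk, hh]
      set A := Polynomial.aeval c ((Polynomial.X - Polynomial.C b) * P)
      clear_value A
      simp only [← mul_assoc, mul_sub, mul_one, sub_mul, hPg', hPfb, zero_mul, sub_zero]
    · rw [hN.add g k hg hki hgk hkg, Finset.sum_insert hb, hNg, hNk, add_comm]

theorem countable_setOf_right_eigenvalue (hS : IsRegularRing S) {N : S → ℝ≥0}
    (hN : IsFaithfulRank N) (c : S) :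
    {b : K | ∃ z : S, z ≠ 0 ∧ (c - algebraMap K S b) * z = 0}.Countable := by
  classical
  have hex : ∀ b : K, ∃ f : S, IsIdempotentElem f ∧ (c - algebraMap K S b) * f = 0 ∧
      ((∃ z : S, z ≠ 0 ∧ (c - algebraMap K S b) * z = 0) → f ≠ 0) := by
    intro b
    by_cases h : ∃ z : S, z ≠ 0 ∧ (c - algebraMap K S b) * z = 0
    · obtain ⟨z, hz, hcz⟩ := h
      obtain ⟨z', hz'⟩ := hS z
      refine ⟨z * z', ?_, ?_, fun _ h0 => hz ?_⟩
      · rw [IsIdempotentElem, ← mul_assoc, hz']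
      · rw [← mul_assoc, hcz, zero_mul]
      · rw [← hz', h0, zero_mul]
    · exact ⟨0, IsIdempotentElem.zero, mul_zero _, fun h' => absurd h' h⟩
  choose f hf hcf hne using hex
  -- A finite sum is N(g) for an idempotent g, and N(g) ≤ N(g) + N(1 - g) = N(1).
  have hsum : Summable fun b => N (f b) := by
    refine NNReal.summable_coe.1 (summable_of_sum_le (c := N 1) (fun _ => NNReal.coe_nonneg _)
      fun F => ?_)
    obtain ⟨g, hg, -, hNg⟩ := exists_idempotent_rank_eq_sum hS hN c f hf hcf F
    have h := hN.add g (1 - g) hg hg.one_sub (by rw [mul_sub, mul_one, hg.eq, sub_self])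
      (by rw [sub_mul, one_mul, hg.eq, sub_self])
    rw [add_sub_cancel] at h
    rw [← NNReal.coe_sum, ← hNg, h]
    exact NNReal.coe_le_coe.2 le_self_add
  refine (Summable.countable_support_nnreal _ hsum).mono fun b hb => ?_
  exact fun h0 => hne b hb (hN.eq_zero _ (hf b) h0)

/-- In a regular ring, an element with zero left and right annihilators is invertible by its
quasi-inverse. The opposite ring handles the left annihilators. -/
theorem countable_setOf_not_isUnit_sub (hS : IsRegularRing S) {N : S → ℝ≥0}
    (hN : IsFaithfulRank N) (c : S) :
    {b : K | ¬ IsUnit (c - algebraMap K S b)}.Countable := by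
  have h1 := countable_setOf_right_eigenvalue (K := K) hS hN c
  have h2 := countable_setOf_right_eigenvalue (K := K) hS.op hN.op (MulOpposite.op c)
  refine (h1.union h2).mono fun b hb => ?_
  by_contra hcon
  simp only [Set.mem_union, Set.mem_ofPred_eq, not_or, not_exists, not_and, not_imp_not] at hcon
  obtain ⟨hr, hl⟩ := hcon
  apply hb
  set d := c - algebraMap K S b with hd
  obtain ⟨d', hd'⟩ := hS d
  have e1 : d' * d = 1 := by
    by_contra h
    exact sub_ne_zero.2 h (hr _ (by rw [mul_sub, mul_one, ← mul_assoc, hd', sub_self]))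
  have e2 : d * d' = 1 := by
    by_contra h
    refine h (sub_eq_zero.1 (MulOpposite.op_injective (hl (.op (d * d' - 1)) ?_)))
    apply MulOpposite.unop_injective
    change (d * d' - 1) * d = 0
    rw [sub_mul, one_mul, hd', sub_self]
  exact ⟨⟨d, d', e2, e1⟩, rfl⟩

theorem exists_isUnit_sub_and_isUnit_sub_inv [Uncountable K] (hS : IsRegularRing S) {N : S → ℝ≥0}
    (hN : IsFaithfulRank N) (x a : S) :
    ∃ t : K, t ≠ 0 ∧ IsUnit (x - algebraMap K S t) ∧ IsUnit (a - algebraMap K S t⁻¹) := by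
  have h1 := countable_setOf_not_isUnit_sub (K := K) hS hN x
  have h2 := (countable_setOf_not_isUnit_sub (K := K) hS hN a).preimage (inv_injective (G := K))
  by_contra! hcon
  refine Set.not_countable_univ (α := K) (((h1.union h2).union (Set.countable_singleton 0)).mono ?_)
  intro t _
  by_cases ht : t = 0
  · exact Or.inr ht
  · by_cases hx : IsUnit (x - algebraMap K S t)
    · exact Or.inl (Or.inr (hcon t ht hx))
    · exact Or.inl (Or.inl hx)

/-- Regular algebras over an uncountable field with a faithful rank have stable range one. -/
theorem exists_isUnit_add_mul [Uncountable K] (hS : IsRegularRing S) {N : S → ℝ≥0}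
    (hN : IsFaithfulRank N) {a x b : S} (h : a * x + b = 1) : ∃ v : S, IsUnit (a + b * v) := by
  obtain ⟨t, ht, ⟨w, hw⟩, ha⟩ := exists_isUnit_sub_and_isUnit_sub_inv (K := K) hS hN x a
  refine ⟨↑w⁻¹, ?_⟩
  -- With w = x - t and b = 1 - ax, one gets aw + b = 1 - ta.
  have key : (a + b * ↑w⁻¹) = -(algebraMap K S t * (a - algebraMap K S t⁻¹)) * ↑w⁻¹ := by
    rw [Units.eq_mul_inv_iff_mul_eq, add_mul, mul_assoc, Units.inv_mul, mul_one,
      eq_sub_of_add_eq' h, hw, mul_sub, mul_sub, ← map_mul, mul_inv_cancel₀ ht, map_one,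
      Algebra.commutes t a]
    abel
  rw [key]
  exact ((((IsUnit.mk0 t ht).map (algebraMap K S)).mul ha).neg).mul (Units.isUnit _)

theorem exists_mul_eq_one_sub [Uncountable K] (hS : IsRegularRing S) {N : S → ℝ≥0}
    (hN : IsFaithfulRank N) {a b : S} (hp : IsIdempotentElem (a * b))
    (hq : IsIdempotentElem (b * a)) :
    ∃ u v : S, u * v = 1 - a * b ∧ v * u = 1 - b * a := by
  set p := a * b with hpd
  set q := b * a with hqd
  obtain ⟨v, w, hw⟩ := exists_isUnit_add_mul (K := K) hS hN (a := p * a) (x := b * p)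
    (b := 1 - p) (by
      have : p * a * (b * p) = p := by
        rw [mul_assoc, ← mul_assoc a, ← hpd, hp.eq, hp.eq]
      rw [this, add_sub_cancel])
  have hpw : p * ↑w = p * a := by
    rw [hw, mul_add, ← mul_assoc, hp.eq, ← mul_assoc, mul_sub, mul_one, hp.eq, sub_self, zero_mul,
      add_zero]
  have hpa : p * a = a * q := by rw [hpd, hqd, mul_assoc]
  -- r is conjugate to p and generates the same left ideal as q, so 1 - p ~ 1 - r ~ 1 - q.
  set r : S := ↑w⁻¹ * p * ↑w with hr
  have hbpw : b * (p * ↑w) = q := by rw [hpw, hpa, ← mul_assoc, ← hqd, hq.eq]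
  have hpwr : p * ↑w * r = p * ↑w := by
    rw [hr, ← mul_assoc, ← mul_assoc, mul_assoc p, Units.mul_inv, mul_one, hp.eq]
  have hqr : q * r = q := by rw [← hbpw, mul_assoc, hpwr]
  have hrq : r * q = r := by
    rw [hr, mul_assoc (↑w⁻¹ : S), hpw, hpa, mul_assoc, mul_assoc a, hq.eq]
  refine ⟨↑w * (1 - q), (1 - r) * ↑w⁻¹, ?_, ?_⟩
  · have h1 : (1 - q) * (1 - r) = 1 - r := by
      simp [mul_sub, sub_mul, hqr]
    rw [← mul_assoc, mul_assoc (w : S), h1, mul_sub, sub_mul, mul_one, Units.mul_inv, hr,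
      ← mul_assoc, ← mul_assoc, Units.mul_inv, one_mul, mul_assoc, Units.mul_inv, mul_one]
  · have h1 : (1 - r) * (1 - q) = 1 - q := by
      simp [mul_sub, sub_mul, hrq]
    rw [mul_assoc, ← mul_assoc _ (w : S), Units.inv_mul, one_mul, h1]

end Unital

/-! ### Passage to corners of nonunital algebras -/

section NonUnital

variable {T : Type*} [NonUnitalRing T]

theorem IsRegularRing.corner (hT : IsRegularRing T) {e : T} (he : IsIdempotentElem e) :
    IsRegularRing he.Corner := fun a => by
  obtain ⟨b, hb⟩ := hT a.1
  obtain ⟨h1, h2⟩ := (Subsemigroup.mem_corner_iff he).1 a.2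
  refine ⟨⟨e * b * e, b, rfl⟩, Subtype.ext ?_⟩
  change a.1 * (e * b * e) * a.1 = a.1
  rw [← mul_assoc, ← mul_assoc, h2, mul_assoc, h1, hb]

theorem IsFaithfulRank.corner {N : T → ℝ≥0} (hN : IsFaithfulRank N) {e : T}
    (he : IsIdempotentElem e) : IsFaithfulRank fun x : he.Corner => N x.1 where
  equiv u v h h' := hN.equiv u.1 v.1 (congrArg Subtype.val h) (congrArg Subtype.val h')
  add p q hp hq h h' := hN.add p.1 q.1 (congrArg Subtype.val hp)
    (congrArg Subtype.val hq) (congrArg Subtype.val h) (congrArg Subtype.val h')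
  eq_zero p hp h := Subtype.ext (hN.eq_zero p.1 (congrArg Subtype.val hp) h)

/-- The corner `e T e` of a nonunital `K`-algebra `T` is a unital `K`-algebra. -/
abbrev cornerAlgebra (K : Type*) [Field K] [Module K T] [IsScalarTower K T T]
    [SMulCommClass K T T] {e : T} (he : IsIdempotentElem e) : Algebra K he.Corner :=
  RingHom.toAlgebra'
    { toFun := fun t => ⟨t • e, t • e, by
        simp only [mul_smul_comm, smul_mul_assoc, he.eq]⟩
      map_one' := Subtype.ext (one_smul K e)
      map_mul' := fun s t => Subtype.ext (by
        change (s * t) • e = (s • e) * (t • e)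
        rw [smul_mul_smul_comm, he.eq])
      map_zero' := Subtype.ext (zero_smul K e)
      map_add' := fun s t => Subtype.ext (add_smul s t e) }
    fun t x => Subtype.ext (by
      obtain ⟨h1, h2⟩ := (Subsemigroup.mem_corner_iff he).1 x.2
      change (t • e) * x.1 = x.1 * (t • e)
      rw [smul_mul_assoc, mul_smul_comm, h1, h2])

/-- Cancellation of equivalent idempotents from two orthogonal decompositions of the same
idempotent. -/
theorem exists_mul_eq_of_add_eq (K : Type*) [Field K] [Uncountable K] [Module K T]
    [IsScalarTower K T T] [SMulCommClass K T T] (hT : IsRegularRing T) {N : T → ℝ≥0}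
    (hN : IsFaithfulRank N) {p q p' q' u v : T} (hp : IsIdempotentElem p)
    (hq : IsIdempotentElem q) (hp' : IsIdempotentElem p')
    (hpq : p * q = 0) (hqp : q * p = 0) (hpq' : p' * q' = 0) (hqp' : q' * p' = 0)
    (hadd : p + q = p' + q') (huv : u * v = p) (hvu : v * u = p') :
    ∃ w z : T, w * z = q ∧ z * w = q' := by
  set e := p + q with hedef
  have he : IsIdempotentElem e := by
    rw [IsIdempotentElem, hedef, add_mul, mul_add, mul_add, hp.eq, hq.eq, hpq, hqp, add_zero,
      zero_add]
  have hep : e * p = p := by rw [hedef, add_mul, hp.eq, hqp, add_zero]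
  have hpe : p * e = p := by rw [hedef, mul_add, hp.eq, hpq, add_zero]
  have hep' : e * p' = p' := by rw [hadd, add_mul, hp'.eq, hqp', add_zero]
  have hpe' : p' * e = p' := by rw [hadd, mul_add, hp'.eq, hpq', add_zero]
  let := cornerAlgebra K he
  -- u and v need not lie in the corner, so they are cut down by p and p'.
  let a : he.Corner := ⟨p * u * p', (Subsemigroup.mem_corner_iff he).2
    ⟨by rw [← mul_assoc, ← mul_assoc, hep], by rw [mul_assoc, hpe']⟩⟩
  let b : he.Corner := ⟨p' * v * p, (Subsemigroup.mem_corner_iff he).2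
    ⟨by rw [← mul_assoc, ← mul_assoc, hep'], by rw [mul_assoc, hpe]⟩⟩
  have hab : (a * b).1 = p := by
    change p * u * p' * (p' * v * p) = p
    calc p * u * p' * (p' * v * p) = p * u * (p' * p') * v * p := by simp only [mul_assoc]
      _ = p * (u * v) * (u * v) * p := by rw [hp'.eq, ← hvu]; simp only [mul_assoc]
      _ = p := by rw [huv, hp.eq, hp.eq, hp.eq]
  have hba : (b * a).1 = p' := by
    change p' * v * p * (p * u * p') = p'
    calc p' * v * p * (p * u * p') = p' * v * (p * p) * u * p' := by simp only [mul_assoc]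
      _ = p' * (v * u) * (v * u) * p' := by rw [hp.eq, ← huv]; simp only [mul_assoc]
      _ = p' := by rw [hvu, hp'.eq, hp'.eq, hp'.eq]
  obtain ⟨w, z, hwz, hzw⟩ := exists_mul_eq_one_sub (K := K) (hT.corner he) (hN.corner he)
    (a := a) (b := b) (Subtype.ext (by change (a * b).1 * (a * b).1 = (a * b).1; rw [hab, hp.eq]))
    (Subtype.ext (by change (b * a).1 * (b * a).1 = (b * a).1; rw [hba, hp'.eq]))
  refine ⟨w.1, z.1, (congrArg Subtype.val hwz).trans ?_, (congrArg Subtype.val hzw).trans ?_⟩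
  · change e - (a * b).1 = q
    rw [hab, hedef, add_sub_cancel_left]
  · change e - (b * a).1 = q'
    rw [hba, hadd, add_sub_cancel_left]

end NonUnital
-- Regularity of matrix rings
section Matrix

variable {R : Type*} [NonUnitalRing R]

section Blocks

variable {ι κ μ ν ρ : Type*} [Fintype ι] [Fintype κ]

theorem fromCols_mul_fromRows (A : Matrix μ ι R) (B : Matrix μ κ R) (C : Matrix ι ν R)
    (D : Matrix κ ν R) :
    Matrix.fromCols A B * Matrix.fromRows C D = (A * C + B * D : Matrix μ ν R) := by
  ext i j
  simp [Matrix.mul_apply, Fintype.sum_sum_type]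

theorem fromRows_mul (A : Matrix μ ι R) (B : Matrix ν ι R) (C : Matrix ι ρ R) :
    Matrix.fromRows A B * C = Matrix.fromRows (A * C) (B * C) := by
  ext (i | i) j <;> simp [Matrix.mul_apply]

theorem fromRows_mul_fromCols {σ : Type*} (A : Matrix μ ι R) (B : Matrix ν ι R)
    (C : Matrix ι ρ R) (D : Matrix ι σ R) :
    Matrix.fromRows A B * Matrix.fromCols C D =
      Matrix.fromBlocks (A * C) (A * D) (B * C) (B * D) := by
  ext (i | i) (j | j) <;> simp [Matrix.mul_apply]

theorem fromBlocks_mul_fromRows {σ : Type*} (A : Matrix μ ι R) (B : Matrix μ κ R)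
    (C : Matrix ν ι R) (D : Matrix ν κ R) (E : Matrix ι σ R) (F : Matrix κ σ R) :
    Matrix.fromBlocks A B C D * Matrix.fromRows E F =
      Matrix.fromRows (A * E + B * F) (C * E + D * F) := by
  ext (i | i) j <;> simp [Matrix.mul_apply, Fintype.sum_sum_type]

end Blocks

/-- McCoy's lemma: the witness is y + (1 - ya)z(1 - ay), expanded because T has no unit. -/
theorem exists_quasiInverse_of_sub {T : Type*} [NonUnitalRing T] {a : T} (y : T)
    (h : ∃ z, (a - a * y * a) * z * (a - a * y * a) = a - a * y * a) : ∃ b, a * b * a = a := by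
  obtain ⟨z, hz⟩ := h
  refine ⟨y + (z - y * a * z - z * a * y + y * a * z * a * y), ?_⟩
  have h2 : a = a * y * a + (a - a * y * a) * z * (a - a * y * a) := by rw [hz]; abel
  conv_rhs => rw [h2]
  noncomm_ring

/-- McCoy's lemma clears the upper right block, then the diagonal blocks, leaving a strictly lower
triangular matrix. -/
theorem IsRegularRing.matrix_sum {ι : Type*} [Fintype ι] (h : IsRegularRing (Matrix ι ι R)) :
    IsRegularRing (Matrix (ι ⊕ ι) (ι ⊕ ι) R) := by
  have h1 : ∀ c : Matrix ι ι R, ∃ z : Matrix (ι ⊕ ι) (ι ⊕ ι) R, Matrix.fromBlocks 0 0 c 0 * z * Matrix.fromBlocks 0 0 c 0 =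
      Matrix.fromBlocks 0 0 c 0 := fun c => by
    obtain ⟨c', hc⟩ := h c
    refine ⟨Matrix.fromBlocks 0 c' 0 0, ?_⟩
    simp [Matrix.fromBlocks_multiply, hc]
  have h2 : ∀ a c d : Matrix ι ι R, ∃ z : Matrix (ι ⊕ ι) (ι ⊕ ι) R, Matrix.fromBlocks a 0 c d * z *
      Matrix.fromBlocks a 0 c d = Matrix.fromBlocks a 0 c d := fun a c d => by
    obtain ⟨a', ha⟩ := h a
    obtain ⟨d', hd⟩ := h d
    refine exists_quasiInverse_of_sub (Matrix.fromBlocks a' 0 0 d') ?_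
    have hX : Matrix.fromBlocks a 0 c d - Matrix.fromBlocks a 0 c d * Matrix.fromBlocks a' 0 0 d' *
        Matrix.fromBlocks a 0 c d = Matrix.fromBlocks 0 0 (c - (c * a' * a + d * d' * c)) 0 := by
      simp [Matrix.fromBlocks_multiply, sub_eq_add_neg, Matrix.fromBlocks_neg,
        Matrix.fromBlocks_add, ha, hd]
    rw [hX]
    exact h1 _
  intro A
  obtain ⟨b', hb⟩ := h A.toBlocks₁₂
  refine exists_quasiInverse_of_sub (Matrix.fromBlocks 0 0 b' 0) ?_
  set X := A - A * Matrix.fromBlocks 0 0 b' 0 * A with hX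
  have hX12 : X.toBlocks₁₂ = 0 := by
    rw [hX, ← Matrix.fromBlocks_toBlocks A]
    simp [Matrix.fromBlocks_multiply, sub_eq_add_neg, Matrix.fromBlocks_neg, Matrix.fromBlocks_add,
      hb]
  rw [← Matrix.fromBlocks_toBlocks X, hX12]
  exact h2 _ _ _

theorem IsRegularRing.matrix_left {ι κ : Type*} [Fintype ι] [Fintype κ]
    (h : IsRegularRing (Matrix (ι ⊕ κ) (ι ⊕ κ) R)) : IsRegularRing (Matrix ι ι R) := fun A => by
  obtain ⟨B, hB⟩ := h (Matrix.fromBlocks A 0 0 0)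
  refine ⟨B.toBlocks₁₁, ?_⟩
  rw [← Matrix.fromBlocks_toBlocks B] at hB
  simpa [Matrix.fromBlocks_multiply] using congrArg Matrix.toBlocks₁₁ hB

theorem IsRegularRing.matrix_reindex {ι κ : Type*} [Fintype ι] [Fintype κ] (σ : κ ≃ ι)
    (h : IsRegularRing (Matrix ι ι R)) : IsRegularRing (Matrix κ κ R) := fun A => by
  obtain ⟨B, hB⟩ := h (A.submatrix σ.symm σ.symm)
  refine ⟨B.submatrix σ σ, ?_⟩
  have := congrArg (fun X => X.submatrix σ σ) hB
  simpa [← Matrix.submatrix_mul_equiv _ _ _ σ] using this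

theorem IsRegularRing.matrix_fin (h : IsRegularRing R) :
    ∀ n : ℕ, IsRegularRing (Matrix (Fin n) (Fin n) R)
  | 0 => fun A => ⟨A, Subsingleton.elim _ _⟩
  | 1 => fun A => by
    obtain ⟨b, hb⟩ := h (A 0 0)
    refine ⟨Matrix.of fun _ _ => b, ?_⟩
    ext i j
    rw [Subsingleton.elim i 0, Subsingleton.elim j 0]
    simpa [Matrix.mul_apply] using hb
  | n + 2 => by
    -- Size n + 2 is a corner of the doubled size 2(n + 1) = (n + 2) + n.
    refine IsRegularRing.matrix_left (κ := Fin n)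
      (((h.matrix_fin (n + 1)).matrix_sum).matrix_reindex ?_)
    exact Fintype.equivOfCardEq (by simp; omega)

end Matrix

/-! ### From faithful homomorphisms on V(R) to cancellation -/

section Rank

variable {R : Type*} [NonUnitalRing R]

theorem V.mk_eq_zero {e : IdemMat R} (h : V.mk e = 0) : e.mat = 0 := by
  obtain ⟨u, v, huv, -⟩ := V.mk_eq_mk.1 (h : V.mk e = V.mk IdemMat.empty)
  rw [← huv]
  ext i j
  rw [Matrix.mul_apply]
  exact Finset.sum_eq_zero fun k _ => (k : Fin 0).elim0

theorem V.mk_add_of_orthogonal {n : ℕ} {e f : Matrix (Fin n) (Fin n) R} (he : e * e = e)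
    (hf : f * f = f) (hef : e * f = 0) (hfe : f * e = 0) (h : (e + f) * (e + f) = e + f) :
    V.mk ⟨n, e + f, h⟩ = V.mk ⟨n, e, he⟩ + V.mk ⟨n, f, hf⟩ := by
  have H : MatEquiv (e + f) (Matrix.fromBlocks e 0 0 f) := by
    refine ⟨Matrix.fromCols e f, Matrix.fromRows e f, ?_, ?_⟩
    · rw [fromCols_mul_fromRows, he, hf]
    · rw [fromRows_mul_fromCols, he, hf, hef, hfe]
  exact V.mk_eq_mk.2 (H.trans h (IdemMat.diag ⟨n, e, he⟩ ⟨n, f, hf⟩).idem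
    (IdemMat.diag_equiv ⟨n, e, he⟩ ⟨n, f, hf⟩))

open Classical in
/-- The rank on `n × n` matrices induced by a homomorphism on `V(R)`. -/
noncomputable def V.rank (s : V R →+ ℝ≥0) (n : ℕ) (e : Matrix (Fin n) (Fin n) R) : ℝ≥0 :=
  -- The default 0 is harmless: `IsFaithfulRank` only constrains values at idempotents.
  if h : e * e = e then s (V.mk ⟨n, e, h⟩) else 0

theorem V.isFaithfulRank {s : V R →+ ℝ≥0} (hs : ∀ m, s m = 0 → m = 0) (n : ℕ) :
    IsFaithfulRank (V.rank s n) where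
  equiv u v h h' := by
    rw [V.rank, V.rank, dif_pos h.eq, dif_pos h'.eq]
    exact congrArg s (V.mk_eq_mk.2 ⟨u, v, rfl, rfl⟩)
  add e f he hf hef hfe := by
    have h : (e + f) * (e + f) = e + f := by
      rw [add_mul, mul_add, mul_add, he.eq, hf.eq, hef, hfe, add_zero, zero_add]
    rw [V.rank, V.rank, V.rank, dif_pos h, dif_pos he.eq, dif_pos hf.eq, ← map_add,
      V.mk_add_of_orthogonal he.eq hf.eq hef hfe h]
  eq_zero e he h := by
    rw [V.rank, dif_pos he.eq] at h
    exact V.mk_eq_zero (hs _ h)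

theorem V.exists_orthogonal {e p q : IdemMat R} (h : V.mk e = V.mk p + V.mk q) :
    ∃ p' q' : Matrix (Fin e.size) (Fin e.size) R, p' * p' = p' ∧ q' * q' = q' ∧ p' * q' = 0 ∧
      q' * p' = 0 ∧ p' + q' = e.mat ∧ MatEquiv p' p.mat ∧ MatEquiv q' q.mat := by
  rw [V.mk_add_mk, V.mk_eq_mk] at h
  obtain ⟨u, v, huv, hvu⟩ := h.trans e.idem (fromBlocks_idem p.idem q.idem)
    (IdemMat.diag_equiv p q).symm
  set B := Matrix.fromBlocks p.mat 0 0 q.mat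
  -- Inclusions and projections of the two blocks, with p and q in place of the missing identity
  -- matrices; u and v carry them over to e.
  let I : Matrix (Fin p.size ⊕ Fin q.size) (Fin p.size) R := Matrix.fromRows p.mat 0
  let J : Matrix (Fin p.size) (Fin p.size ⊕ Fin q.size) R := Matrix.fromCols p.mat 0
  let I' : Matrix (Fin p.size ⊕ Fin q.size) (Fin q.size) R := Matrix.fromRows 0 q.mat
  let J' : Matrix (Fin q.size) (Fin p.size ⊕ Fin q.size) R := Matrix.fromCols 0 q.mat
  have hBI : B * I = I := by simp [B, I, fromBlocks_mul_fromRows, p.idem]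
  have hBI' : B * I' = I' := by simp [B, I', fromBlocks_mul_fromRows, q.idem]
  have hJI : J * I = p.mat := by simp [J, I, fromCols_mul_fromRows, p.idem]
  have hJI' : J' * I' = q.mat := by simp [J', I', fromCols_mul_fromRows, q.idem]
  have h0 : J * I' = 0 := by simp [J, I', fromCols_mul_fromRows]
  have h0' : J' * I = 0 := by simp [J', I, fromCols_mul_fromRows]
  have hIp : I * p.mat = I := by simp [I, fromRows_mul, p.idem]
  have hIq : I' * q.mat = I' := by simp [I', fromRows_mul, q.idem]
  have hB : I * J + I' * J' = B := by
    simp [B, I, J, I', J', fromRows_mul_fromCols, Matrix.fromBlocks_add, p.idem, q.idem]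
  clear_value B I J I' J'
  have key : ∀ {m n : ℕ} (x : Matrix (Fin m) (Fin p.size ⊕ Fin q.size) R)
      (y : Matrix (Fin p.size ⊕ Fin q.size) (Fin n) R), x * v * (u * y) = x * (B * y) :=
    fun x y => by rw [← hvu]; simp only [Matrix.mul_assoc]
  have k1 : J * v * (u * I) = p.mat := by rw [key, hBI, hJI]
  have k2 : J' * v * (u * I') = q.mat := by rw [key, hBI', hJI']
  have k3 : J * v * (u * I') = 0 := by rw [key, hBI', h0]
  have k4 : J' * v * (u * I) = 0 := by rw [key, hBI, h0']
  refine ⟨u * I * (J * v), u * I' * (J' * v), ?_, ?_, ?_, ?_, ?_, ⟨u * I, J * v, rfl, k1⟩,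
    ⟨u * I', J' * v, rfl, k2⟩⟩
  · rw [Matrix.mul_assoc, ← Matrix.mul_assoc (J * v), k1, ← Matrix.mul_assoc, Matrix.mul_assoc u,
      hIp]
  · rw [Matrix.mul_assoc, ← Matrix.mul_assoc (J' * v), k2, ← Matrix.mul_assoc, Matrix.mul_assoc u,
      hIq]
  · rw [Matrix.mul_assoc, ← Matrix.mul_assoc (J * v), k3, Matrix.zero_mul, Matrix.mul_zero]
  · rw [Matrix.mul_assoc, ← Matrix.mul_assoc (J' * v), k4, Matrix.zero_mul, Matrix.mul_zero]
  · calc u * I * (J * v) + u * I' * (J' * v) = u * (I * J + I' * J') * v := by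
          rw [Matrix.mul_add, Matrix.add_mul]; simp only [Matrix.mul_assoc]
      _ = (u * v) * (u * v) := by rw [hB, ← hvu]; simp only [Matrix.mul_assoc]
      _ = e.mat := by rw [huv, e.idem]

/-- If `R` is a regular algebra over an uncountable field and `V(R)` has a faithful homomorphism
to the nonnegative reals, then `V(R)` is cancellative. -/
theorem V.add_left_cancel_of_faithful (K : Type*) [Field K] [Uncountable K] [Module K R]
    [IsScalarTower K R R] [SMulCommClass K R R] (hR : IsRegularRing R) {s : V R →+ ℝ≥0}
    (hs : ∀ m, s m = 0 → m = 0) {a b c : V R} (h : a + b = a + c) : b = c := by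
  induction a using Quotient.inductionOn with | _ p
  induction b using Quotient.inductionOn with | _ q
  induction c using Quotient.inductionOn with | _ r
  change V.mk p + V.mk q = V.mk p + V.mk r at h
  change V.mk q = V.mk r
  obtain ⟨p₁, q₁, hp₁, hq₁, hpq₁, hqp₁, h₁, ep₁, eq₁⟩ :=
    V.exists_orthogonal (e := p.diag q) (V.mk_add_mk p q).symm
  obtain ⟨p₂, r₂, hp₂, hr₂, hpr₂, hrp₂, h₂, ep₂, er₂⟩ :=
    V.exists_orthogonal (e := p.diag q) ((V.mk_add_mk p q).symm.trans h)
  obtain ⟨u, v, huv, hvu⟩ := ep₁.trans hp₁ hp₂ ep₂.symm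
  have hqr : MatEquiv q₁ r₂ := exists_mul_eq_of_add_eq K (hR.matrix_fin _)
    (V.isFaithfulRank hs _) hp₁ hq₁ hp₂ hpq₁ hqp₁ hpr₂ hrp₂ (h₁.trans h₂.symm) huv hvu
  rw [V.mk_eq_mk]
  exact (eq₁.symm.trans q.idem hr₂ hqr).trans q.idem r.idem er₂

end Rank
-- Noncancellation and the faithful state of the presented monoid
namespace M

/-- The homomorphism on `M` induced by values on the generators that respect the relations. -/
def lift {N : Type*} [AddCommMonoid N] (f : Gen → N)
    (base : f (.x 0) + f (.y 0) = f (.x 0) + f (.z 0))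
    (hy : ∀ l, f (.y l) = f (.y (l + 1)) + f (.a l))
    (hz : ∀ l, f (.z l) = f (.z (l + 1)) + f (.a l))
    (hxy : ∀ l, f (.x l) = f (.x (l + 1)) + f (.y (l + 1)))
    (hxz : ∀ l, f (.x l) = f (.x (l + 1)) + f (.z (l + 1))) : M →+ N :=
  AddCon.lift _ (Multiset.sumAddMonoidHom.comp (Multiset.mapAddMonoidHom f))
    (AddCon.addConGen_le.2 fun a b h => by
      cases h <;> simp [AddCon.ker_rel, base, ← hy, ← hz, ← hxy, ← hxz])

theorem lift_of {N : Type*} [AddCommMonoid N] (f : Gen → N) (base hy hz hxy hxz) (g : Gen) :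
    lift f base hy hz hxy hxz (M.of g) = f g :=
  Multiset.sum_singleton _

theorem of_add_of_eq {g h k : Gen} (H : Rel {g} ({h} + {k})) :
    of g = of h + of k :=
  (AddCon.eq _).2 (AddConGen.Rel.of _ _ H)

theorem base : of (.x 0) + of (.y 0) = of (.x 0) + of (.z 0) :=
  (AddCon.eq _).2 (AddConGen.Rel.of _ _ Rel.base)

theorem y_ne_z : of (.y 0) ≠ of (.z 0) := by
  -- The absorbing value ⊤ on every x trivializes the relations involving x; the others only ask y
  -- and z to be constant once a is 0.
  let f : Gen → ℕ∞ := fun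
    | .x _ => ⊤
    | .y _ => 0
    | .z _ => 1
    | .a _ => 0
  intro h
  have := congrArg (lift f (by simp [f]) (by simp [f]) (by simp [f]) (by simp [f]) (by simp [f])) h
  simp [lift_of, f] at this

@[elab_as_elim]
theorem induction {P : M → Prop} (zero : P 0) (of_add : ∀ g m, P m → P (of g + m)) (m : M) :
    P m := by
  induction m using AddCon.induction_on with | _ m
  induction m using Multiset.induction_on with
  | empty => exact zero
  | cons g m ih => exact of_add g m ih

/-- Values of a faithful state on the generators. -/
noncomputable def weight : Gen → ℝ≥0
  | .x l => 2⁻¹ ^ (l + 1)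
  | .y l => 2⁻¹ ^ (l + 1)
  | .z l => 2⁻¹ ^ (l + 1)
  | .a l => 2⁻¹ ^ (l + 2)

theorem weight_pos (g : Gen) : 0 < weight g := by
  cases g <;> simp [weight]

theorem two_inv_pow_succ (l : ℕ) : (2⁻¹ : ℝ≥0) ^ (l + 1) = 2⁻¹ ^ (l + 2) + 2⁻¹ ^ (l + 2) := by
  rw [← two_mul, pow_succ' _ (l + 1), mul_inv_cancel_left₀ two_ne_zero]

/-- A faithful state on `M`. -/
noncomputable def state : M →+ ℝ≥0 :=
  lift weight rfl two_inv_pow_succ two_inv_pow_succ two_inv_pow_succ two_inv_pow_succ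

theorem state_of (g : Gen) : state (of g) = weight g :=
  lift_of _ _ _ _ _ _ g

/-- Both summands of an element below u are below u; every generator arises by splitting x₀, y₀ or
z₀ repeatedly. -/
theorem exists_of_add_eq_u (g : Gen) : ∃ c, of g + c = u := by
  have trans : ∀ {g h k : Gen}, Rel {g} ({h} + {k}) → (∃ c, of g + c = u) →
      (∃ c, of h + c = u) ∧ ∃ c, of k + c = u := by
    rintro g h k H ⟨c, hc⟩
    rw [of_add_of_eq H] at hc
    exact ⟨⟨of k + c, by rw [← add_assoc, hc]⟩, ⟨of h + c, by rw [← hc]; abel⟩⟩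
  have hx : ∀ l, ∃ c, of (.x l) + c = u := fun l => by
    induction l with
    | zero => exact ⟨_, rfl⟩
    | succ l ih => exact (trans (Rel.xy l) ih).1
  have hy : ∀ l, ∃ c, of (.y l) + c = u := fun l => by
    induction l with
    | zero => exact ⟨of (.x 0), add_comm _ _⟩
    | succ l ih => exact (trans (Rel.y l) ih).1
  have hz : ∀ l, ∃ c, of (.z l) + c = u := fun l => by
    induction l with
    | zero => exact ⟨of (.x 0), by rw [add_comm, ← base, u]⟩
    | succ l ih => exact (trans (Rel.z l) ih).1
  match g with
  | .x l => exact hx l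
  | .y l => exact hy l
  | .z l => exact hz l
  | .a l => exact (trans (Rel.y l) (hy l)).2

theorem isOrderUnit_u : IsOrderUnit u := fun m => by
  induction m using M.induction with
  | zero => exact ⟨0, 0, by simp⟩
  | of_add g m ih =>
    obtain ⟨k, c, hc⟩ := ih
    obtain ⟨d, hd⟩ := exists_of_add_eq_u g
    exact ⟨k + 1, c + d, by rw [succ_nsmul, ← hc, ← hd]; abel⟩

theorem isFaithfulState_state : IsFaithfulState u state where
  orderUnit := isOrderUnit_u
  map_unit := by
    rw [u, map_add, state_of, state_of]
    change (2⁻¹ : ℝ≥0) ^ 1 + 2⁻¹ ^ 1 = 1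
    rw [pow_one, ← two_mul, mul_inv_cancel₀ two_ne_zero]
  faithful m := by
    induction m using M.induction with
    | zero => exact fun _ => rfl
    | of_add g m _ =>
      intro h
      rw [map_add, add_eq_zero, state_of] at h
      exact absurd h.1 (weight_pos g).ne'

end M

end WildMonoid

theorem proposition4p6 :
    (∃ s : WildMonoid.M →+ ℝ≥0, WildMonoid.IsFaithfulState WildMonoid.M.u s) ∧
    ¬ IsCancelAdd WildMonoid.M ∧
    ∀ (K : Type*) [Field K] [Uncountable K]
      (R : Type*) [NonUnitalRing R] [Module K R] [IsScalarTower K R R] [SMulCommClass K R R],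
      WildMonoid.IsRegularRing R → ¬ Nonempty (WildMonoid.M ≃+ WildMonoid.V R) := by
  refine ⟨⟨WildMonoid.M.state, WildMonoid.M.isFaithfulState_state⟩,
    fun _ => WildMonoid.M.y_ne_z (add_left_cancel WildMonoid.M.base), ?_⟩
  rintro K _ _ R _ _ _ _ hR ⟨φ⟩
  refine WildMonoid.M.y_ne_z (φ.injective ?_)
  refine WildMonoid.V.add_left_cancel_of_faithful K hR
    -- The faithful state of `M` is transported to V(R), where x₀ can then be cancelled from the
    -- base relation.
    (s := WildMonoid.M.state.comp φ.symm.toAddMonoidHom) (a := φ (.of (.x 0))) (fun m hm => ?_) ?_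
  · exact (map_eq_zero_iff φ.symm φ.symm.injective).1
      (WildMonoid.M.isFaithfulState_state.faithful _ hm)
  · rw [← map_add, ← map_add, WildMonoid.M.base]
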